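/- Let $H$ be a complex Hilbert space, let $p>1$ be a real number, and let $a=(a_1,a_2,\dots)$ be a sequence of bounded positive semi-definite operators on $H$ such that the infinite sum $\sum_{n=1}^\infty a_n^p$ converges in the strong operator topology to a bounded trace class operator. Then $\sum_{n=1}^\infty\left(\frac1n\sum_{k=1}^n a_k\right)^p$ also converges in the strong operator topology to a bounded trace class operator, and $$\mathrm{Tr}\sum_{n=1}^\infty\left(\frac1n\sum_{k=1}^n a_k\right)^p\le\left(\frac{p}{p-1}\right)^p\,\mathrm{Tr}\sum_{n=1}^\infty a_n^p .$$ The constant $(p/(p-1))^p$ is best possible: if $H\neq\{0\}$ and $C<(p/(p-1))^p$, then there is a sequence of bounded positive semi-definite operators on $H$, with only finitely many non-zero terms, for which both sums converge in the strong operator topology to trace class operators and $$\mathrm{Tr}\sum_{n=1}^\infty\left(\frac1n\sum_{k=1}^n a_k\right)^p> C\,\mathrm{Tr}\sum_{n=1}^\infty a_n^p .$$ -/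

import Mathlib

open scoped ENNReal

section TraceClass

variable {H : Type*} [NormedAddCommGroup H] [InnerProductSpace ℂ H] [CompleteSpace H]

/-- The index set of a fixed orthonormal (Hilbert) basis of `H`. -/
def refBasisSet (H : Type*) [NormedAddCommGroup H] [InnerProductSpace ℂ H] [CompleteSpace H] :
    Set H :=
  (exists_hilbertBasis ℂ H).choose

/-- A fixed orthonormal (Hilbert) basis of `H`. The notions below do not depend on it, see
`isTraceClass_iff_of_basis` and `trace_eq_of_basis`. -/
noncomputable def refBasis (H : Type*) [NormedAddCommGroup H] [InnerProductSpace ℂ H]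
    [CompleteSpace H] : HilbertBasis (refBasisSet H) ℂ H :=
  (exists_hilbertBasis ℂ H).choose_spec.choose

/-- A bounded operator `T` is trace class if the trace of its modulus `|T| = (T* T)^(1/2)`,
`∑ i, ⟪e i, |T| e i⟫`, is finite. -/
def IsTraceClass (T : H →L[ℂ] H) : Prop :=
  Summable fun i => (inner ℂ (refBasis H i) (CFC.abs T (refBasis H i))).re

/-- The trace `∑ i, ⟪e i, T e i⟫` of a trace class operator `T`. -/
noncomputable def operatorTrace (T : H →L[ℂ] H) : ℂ :=
  ∑' i, inner ℂ (refBasis H i) (T (refBasis H i))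

/-- The series `∑ n, A n` defines the bounded operator `S`: it converges to `S` in the strong
operator topology. (For positive operators this is the same as weak convergence.) -/
def HasOperatorSum (A : ℕ → H →L[ℂ] H) (S : H →L[ℂ] H) : Prop :=
  ∀ x : H, HasSum (fun n => A n x) (S x)

/-- The Hardy operator of arithmetic means. Sequences are indexed from `0`, so that
`hardyMean a n` is the mean of the first `n + 1` terms of the sequence `a`. -/
noncomputable def hardyMean (a : ℕ → H →L[ℂ] H) (n : ℕ) : H →L[ℂ] H :=
  ((n : ℝ) + 1)⁻¹ • ∑ k ∈ Finset.range (n + 1), a k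

theorem ennreal_parseval {ι : Type*} (d : HilbertBasis ι ℂ H) (x : H) :
    ENNReal.ofReal (‖x‖ ^ 2) = ∑' i, ENNReal.ofReal (‖inner ℂ (d i) x‖ ^ 2) := by
  have h := Complex.hasSum_re (d.hasSum_inner_mul_inner x x)
  have h2 : (fun i => (inner ℂ x (d i) * inner ℂ (d i) x).re)
      = fun i => ‖inner ℂ (d i) x‖ ^ 2 := by
    funext i
    rw [← inner_conj_symm x (d i), ← Complex.normSq_eq_conj_mul_self, Complex.ofReal_re,
      Complex.normSq_eq_norm_sq]
  rw [h2] at h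
  have h3 : (inner ℂ x x).re = ‖x‖ ^ 2 := inner_self_eq_norm_sq (𝕜 := ℂ) x
  rw [h3] at h
  rw [← h.tsum_eq, ENNReal.ofReal_tsum_of_nonneg (fun _ => sq_nonneg _) h.summable]

theorem ennreal_trace_eq {ι κ : Type*} (b : HilbertBasis ι ℂ H) (c : HilbertBasis κ ℂ H)
    (R : H →L[ℂ] H) (hR : IsSelfAdjoint R) :
    ∑' i, ENNReal.ofReal (‖R (b i)‖ ^ 2) = ∑' j, ENNReal.ofReal (‖R (c j)‖ ^ 2) := by
  calc ∑' i, ENNReal.ofReal (‖R (b i)‖ ^ 2)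
      = ∑' i, ∑' j, ENNReal.ofReal (‖inner ℂ (c j) (R (b i))‖ ^ 2) :=
        tsum_congr fun i => ennreal_parseval c _
    _ = ∑' j, ∑' i, ENNReal.ofReal (‖inner ℂ (c j) (R (b i))‖ ^ 2) := ENNReal.tsum_comm
    _ = ∑' j, ENNReal.ofReal (‖R (c j)‖ ^ 2) := by
        refine tsum_congr fun j => ?_
        rw [ennreal_parseval b]
        refine tsum_congr fun i => ?_
        have := hR.isSymmetric (c j) (b i)
        simp only [ContinuousLinearMap.coe_coe] at this
        rw [← this, norm_inner_symm]

theorem inner_eq_norm_sqrt_sq (T : H →L[ℂ] H) (hT : 0 ≤ T) (x : H) :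
    inner ℂ x (T x) = ((‖CFC.sqrt T x‖ ^ 2 : ℝ) : ℂ) := by
  have hs : IsSelfAdjoint (CFC.sqrt T) := IsSelfAdjoint.of_nonneg (CFC.sqrt_nonneg T)
  have h := hs.isSymmetric x (CFC.sqrt T x)
  simp only [ContinuousLinearMap.coe_coe] at h
  have h2 : CFC.sqrt T (CFC.sqrt T x) = T x := by
    conv_rhs => rw [← CFC.sqrt_mul_sqrt_self T hT]
    rfl
  rw [h2] at h
  rw [← h, inner_self_eq_norm_sq_to_K]
  norm_cast

/-- Being trace class may be tested in any orthonormal basis. -/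
theorem isTraceClass_iff_of_basis {ι : Type*} (b : HilbertBasis ι ℂ H) (T : H →L[ℂ] H) :
    IsTraceClass T ↔ Summable fun i => (inner ℂ (b i) (CFC.abs T (b i))).re := by
  unfold IsTraceClass
  simp only [inner_eq_norm_sqrt_sq _ (CFC.abs_nonneg T), Complex.ofReal_re]
  have hs : IsSelfAdjoint (CFC.sqrt (CFC.abs T)) := IsSelfAdjoint.of_nonneg (CFC.sqrt_nonneg _)
  have key := ennreal_trace_eq (refBasis H) b _ hs
  constructor
  · intro h
    have h1 := h.tsum_ofReal_ne_top
    rw [key] at h1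
    have h2 := ENNReal.summable_toReal h1
    simpa using h2
  · intro h
    have h1 := h.tsum_ofReal_ne_top
    rw [← key] at h1
    have h2 := ENNReal.summable_toReal h1
    simpa using h2

/-- The trace of a positive operator may be computed in any orthonormal basis. -/
theorem trace_eq_of_basis {ι : Type*} (b : HilbertBasis ι ℂ H) (T : H →L[ℂ] H) (hT : 0 ≤ T) :
    operatorTrace T = ∑' i, inner ℂ (b i) (T (b i)) := by
  unfold operatorTrace
  simp only [inner_eq_norm_sqrt_sq _ hT]
  have hs : IsSelfAdjoint (CFC.sqrt T) := IsSelfAdjoint.of_nonneg (CFC.sqrt_nonneg _)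
  have key := congrArg ENNReal.toReal (ennreal_trace_eq (refBasis H) b _ hs)
  rw [ENNReal.tsum_toReal_eq (by simp), ENNReal.tsum_toReal_eq (by simp)] at key
  simp only [ENNReal.toReal_ofReal (sq_nonneg _)] at key
  rw [← Complex.ofReal_tsum, ← Complex.ofReal_tsum, key]

end TraceClass

/-!
The inequality is reduced to Elliott's telescoping proof of Hardy's inequality for real sequences.
Write `q = p / (p - 1)` and let `c` be the mean of `n` nonnegative numbers with mean `z` and of one
further number `y`. Two applications of Young's inequality give (`hardy_step`)
`(1 + q * (n + 1)) * c ^ p ≤ q ^ p * y ^ p + q * n * z ^ p`,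
and the sum over `n` telescopes.

For operators, the mean `C` of `n + 1` terms satisfies `(n + 1) • C = n • B + A`, with `B` the
preceding mean and `A` the last term. In an orthonormal basis of eigenvectors of `C` the numerical
step applies to the diagonal entries of `C`, `B` and `A`. Those of `C` to the power `p` are the
diagonal entries of `C ^ p` (`rpow_apply_eigenvector`), and those of `A` and `B` to the power `p`
are at most the diagonal entries of `A ^ p` and `B ^ p` by Jensen's inequality (`re_inner_rpow_le`).
Since the trace of a positive operator does not depend on the basis, the step holds for traces
(`traceENN_hardy_step`), although the eigenbasis changes with `n`, and telescopes as before
(`sum_traceENN_hardyMean_le`).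

An eigenbasis of `C` exists because `C` is compact: `A ^ p` has finite trace, so its square root is
Hilbert-Schmidt and `A ^ p` is compact (`isCompactOperator_of_traceENN_ne_top`), hence so is `A`
(`isCompactOperator_of_rpow`). The powers of the means have a sum because their norms are bounded by
their traces. Traces are taken in `[0, ∞]`, where sums may be interchanged freely.

The constant is already optimal for multiples of a rank one projection, where the operators
behave like real numbers: for the sequence `k ^ (-1 / p)`, cut off at `N`, the sum of the `p`-th
powers is the harmonic sum, and the `p`-th power of the `n`-th mean is asymptotic to `q ^ p / n`
(`exists_lt_sum_mean_rpow`).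
-/

/-! ### The trace of positive operators with values in `[0, ∞]` -/

section Trace

variable {H : Type*} [NormedAddCommGroup H] [InnerProductSpace ℂ H]

theorem HasOperatorSum.hasSum_re_inner {A : ℕ → H →L[ℂ] H} {S : H →L[ℂ] H}
    (h : HasOperatorSum A S) (x : H) :
    HasSum (fun n => (inner ℂ x (A n x)).re) (inner ℂ x (S x)).re :=
  Complex.hasSum_re ((h x).mapL (innerSL ℂ x))

variable [CompleteSpace H]

/-- The trace of a positive operator as an extended nonnegative real number, `∞` if the operator
is not trace class. (For an operator that is not positive the value has no meaning.) -/
noncomputable def traceENN (B : H →L[ℂ] H) : ℝ≥0∞ :=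
  ∑' i, ENNReal.ofReal (inner ℂ (refBasis H i) (B (refBasis H i))).re

theorem re_inner_apply_nonneg {B : H →L[ℂ] H} (hB : 0 ≤ B) (x : H) :
    0 ≤ (inner ℂ x (B x)).re := by
  rw [inner_eq_norm_sqrt_sq B hB x, Complex.ofReal_re]
  positivity

theorem traceENN_eq_tsum_norm_sqrt_sq {ι : Type*} (b : HilbertBasis ι ℂ H) {B : H →L[ℂ] H}
    (hB : 0 ≤ B) : traceENN B = ∑' i, ENNReal.ofReal (‖CFC.sqrt B (b i)‖ ^ 2) := by
  rw [← ennreal_trace_eq (refBasis H) b _ (IsSelfAdjoint.of_nonneg (CFC.sqrt_nonneg B))]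
  simp only [traceENN, inner_eq_norm_sqrt_sq B hB, Complex.ofReal_re]

theorem traceENN_eq_of_basis {ι : Type*} (b : HilbertBasis ι ℂ H) {B : H →L[ℂ] H} (hB : 0 ≤ B) :
    traceENN B = ∑' i, ENNReal.ofReal (inner ℂ (b i) (B (b i))).re := by
  simp only [traceENN_eq_tsum_norm_sqrt_sq b hB, inner_eq_norm_sqrt_sq B hB, Complex.ofReal_re]

theorem isTraceClass_iff_traceENN_ne_top {B : H →L[ℂ] H} (hB : 0 ≤ B) :
    IsTraceClass B ↔ traceENN B ≠ ∞ := by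
  unfold IsTraceClass
  rw [CFC.abs_of_nonneg B hB]
  refine ⟨fun h => h.tsum_ofReal_ne_top, fun h => ?_⟩
  have h2 := ENNReal.summable_toReal h
  simpa only [ENNReal.toReal_ofReal (re_inner_apply_nonneg hB _)] using h2

theorem operatorTrace_re_eq_toReal {B : H →L[ℂ] H} (hB : 0 ≤ B) :
    (operatorTrace B).re = (traceENN B).toReal := by
  unfold operatorTrace traceENN
  simp only [inner_eq_norm_sqrt_sq B hB, Complex.ofReal_re]
  rw [← Complex.ofReal_tsum, Complex.ofReal_re, ENNReal.tsum_toReal_eq (by simp)]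
  simp only [ENNReal.toReal_ofReal (sq_nonneg _)]

theorem HasOperatorSum.nonneg {A : ℕ → H →L[ℂ] H} {S : H →L[ℂ] H}
    (h : HasOperatorSum A S) (hA : ∀ n, 0 ≤ A n) : 0 ≤ S := by
  rw [ContinuousLinearMap.nonneg_iff_isPositive, ContinuousLinearMap.isPositive_iff_complex]
  intro x
  have hsum := (h x).mapL (innerSL ℂ x)
  have him : (inner ℂ x (S x)).im = 0 := by
    refine (Complex.hasSum_im hsum).unique ?_
    simp only [innerSL_apply_apply, inner_eq_norm_sqrt_sq _ (hA _), Complex.ofReal_im]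
    exact hasSum_zero
  have hre := (h.hasSum_re_inner x).nonneg fun n => re_inner_apply_nonneg (hA n) x
  have hconj : inner ℂ (S x) x = inner ℂ x (S x) := by
    rw [← inner_conj_symm (S x) x, Complex.conj_eq_iff_im.2 him]
  rw [hconj]
  exact ⟨Complex.ext rfl him.symm, hre⟩

/-- The trace is countably additive on positive operators. -/
theorem HasOperatorSum.traceENN_eq {A : ℕ → H →L[ℂ] H} {S : H →L[ℂ] H}
    (h : HasOperatorSum A S) (hA : ∀ n, 0 ≤ A n) : traceENN S = ∑' n, traceENN (A n) := by
  unfold traceENN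
  rw [ENNReal.tsum_comm]
  refine tsum_congr fun i => ?_
  have h1 := h.hasSum_re_inner (refBasis H i)
  rw [← h1.tsum_eq, ENNReal.ofReal_tsum_of_nonneg
    (fun n => re_inner_apply_nonneg (hA n) _) h1.summable]

/-- Projecting the range of a Hilbert-Schmidt operator onto finitely many vectors of an orthonormal
basis leaves an error controlled by the tail of the Hilbert-Schmidt norm. -/
theorem norm_sub_sum_inner_smul_sq_le {ι : Type*} (b : HilbertBasis ι ℂ H) {R : H →L[ℂ] H}
    (hR : IsSelfAdjoint R) (F : Finset ι) (x : H) :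
    ENNReal.ofReal (‖R x - ∑ i ∈ F, inner ℂ (b i) (R x) • b i‖ ^ 2) ≤
      (∑' i : {i // i ∉ F}, ENNReal.ofReal (‖R (b i)‖ ^ 2)) * ENNReal.ofReal (‖x‖ ^ 2) := by
  classical
  rw [ennreal_parseval b, ← ENNReal.tsum_mul_right]
  have hcoef : ∀ j, inner ℂ (b j) (R x - ∑ i ∈ F, inner ℂ (b i) (R x) • b i)
      = if j ∈ F then 0 else inner ℂ (b j) (R x) := by
    intro j
    rw [inner_sub_right, inner_sum]
    simp only [inner_smul_right, orthonormal_iff_ite.1 b.orthonormal]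
    simp only [mul_ite, mul_one, mul_zero, Finset.sum_ite_eq]
    split_ifs <;> simp
  have hsub : (fun j => ENNReal.ofReal
      (‖inner ℂ (b j) (R x - ∑ i ∈ F, inner ℂ (b i) (R x) • b i)‖ ^ 2)).support ⊆
      {j | j ∉ F} := by
    intro j hj hF
    simp [hcoef, hF] at hj
  rw [← tsum_subtype_eq_of_support_subset hsub]
  refine ENNReal.tsum_le_tsum fun j => ?_
  rw [← ENNReal.ofReal_mul (sq_nonneg _)]
  refine ENNReal.ofReal_le_ofReal ?_
  rw [hcoef, if_neg j.2, ← mul_pow]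
  -- Moving `R` to the basis vector bounds the coefficient by `‖R (b j)‖ * ‖x‖`.
  have := hR.isSymmetric (b j) x
  simp only [ContinuousLinearMap.coe_coe] at this
  rw [← this]
  gcongr
  exact norm_inner_le_norm _ _

theorem norm_sqrt_sq {B : H →L[ℂ] H} (hB : 0 ≤ B) : ‖CFC.sqrt B‖ ^ 2 = ‖B‖ := by
  have hs : IsSelfAdjoint (CFC.sqrt B) := IsSelfAdjoint.of_nonneg (CFC.sqrt_nonneg B)
  rw [← hs.norm_mul_self, CFC.sqrt_mul_sqrt_self B hB]

/-- The case of no basis vectors in `norm_sub_sum_inner_smul_sq_le`: the operator norm of the square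
root is at most its Hilbert-Schmidt norm. -/
theorem ofReal_norm_le_traceENN {B : H →L[ℂ] H} (hB : 0 ≤ B) :
    ENNReal.ofReal ‖B‖ ≤ traceENN B := by
  rcases eq_or_ne (traceENN B) ∞ with h | h
  · simp [h]
  rw [← norm_sqrt_sq hB, ENNReal.ofReal_le_iff_le_toReal h,
    ← Real.le_sqrt (norm_nonneg _) ENNReal.toReal_nonneg]
  refine ContinuousLinearMap.opNorm_le_bound _ (Real.sqrt_nonneg _) fun x => ?_
  have h1 := norm_sub_sum_inner_smul_sq_le (refBasis H)
    (IsSelfAdjoint.of_nonneg (CFC.sqrt_nonneg B)) ∅ x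
  have h2 : (∑' i : {i // i ∉ (∅ : Finset (refBasisSet H))},
      ENNReal.ofReal (‖CFC.sqrt B (refBasis H i)‖ ^ 2)) ≤ traceENN B := by
    rw [traceENN_eq_tsum_norm_sqrt_sq (refBasis H) hB]
    exact ENNReal.tsum_comp_le_tsum_of_injective Subtype.val_injective _
  have h3 := h1.trans (mul_le_mul_left h2 _)
  rw [ENNReal.ofReal_le_iff_le_toReal (ENNReal.mul_ne_top h ENNReal.ofReal_ne_top),
    ENNReal.toReal_mul, ENNReal.toReal_ofReal (sq_nonneg _)] at h3
  simp only [Finset.sum_empty, sub_zero] at h3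
  refine (sq_le_sq₀ (norm_nonneg _) (by positivity)).1 ?_
  rwa [mul_pow, Real.sq_sqrt ENNReal.toReal_nonneg]

/-- Positive operators with summable traces have a strongly (even absolutely) convergent sum. -/
theorem exists_hasOperatorSum_of_tsum_traceENN_ne_top {A : ℕ → H →L[ℂ] H} (hA : ∀ n, 0 ≤ A n)
    (h : ∑' n, traceENN (A n) ≠ ∞) : ∃ T, HasOperatorSum A T := by
  have h1 : Summable fun n => ‖A n‖ := by
    have h2 : ∑' n, ENNReal.ofReal ‖A n‖ ≠ ∞ :=
      ne_top_of_le_ne_top h (ENNReal.tsum_le_tsum fun n => ofReal_norm_le_traceENN (hA n))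
    simpa using ENNReal.summable_toReal h2
  refine ⟨∑' n, A n, fun x => ?_⟩
  exact h1.of_norm.hasSum.mapL (ContinuousLinearMap.apply ℂ H x)

end Trace

/-! ### Compactness and diagonalisation -/

section Compact

variable {H : Type*} [NormedAddCommGroup H] [InnerProductSpace ℂ H]

theorem isCompactOperator_sum {ι : Type*} (s : Finset ι) {A : ι → H →L[ℂ] H}
    (h : ∀ i, IsCompactOperator (A i)) : IsCompactOperator (∑ i ∈ s, A i : H →L[ℂ] H) :=
  show (∑ i ∈ s, A i) ∈ compactOperator (RingHom.id ℂ) H H from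
    Submodule.sum_mem _ fun i _ => h i

variable [CompleteSpace H]

open Filter Topology

/-- A positive operator of finite trace is compact: its square root is Hilbert-Schmidt, hence a norm
limit of its compressions to finitely many basis vectors. -/
theorem isCompactOperator_of_traceENN_ne_top {B : H →L[ℂ] H} (hB : 0 ≤ B)
    (h : traceENN B ≠ ∞) : IsCompactOperator B := by
  set R := CFC.sqrt B
  have hR : IsSelfAdjoint R := IsSelfAdjoint.of_nonneg (CFC.sqrt_nonneg B)
  set b := refBasis H
  have h' : ∑' i, ENNReal.ofReal (‖R (b i)‖ ^ 2) ≠ ∞ := by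
    rwa [← traceENN_eq_tsum_norm_sqrt_sq b hB]
  let P : Finset (refBasisSet H) → H →L[ℂ] H := fun F =>
    (∑ i ∈ F, InnerProductSpace.rankOne ℂ (b i) (b i)) * R
  have hPx : ∀ F x, P F x = ∑ i ∈ F, inner ℂ (b i) (R x) • b i := by
    intro F x
    simp [P]
  have hRc : IsCompactOperator R := by
    refine isCompactOperator_of_tendsto (F := P) (l := atTop) ?_ (Eventually.of_forall fun F => ?_)
    · rw [tendsto_iff_norm_sub_tendsto_zero]
      have htail := (ENNReal.tendsto_toReal ENNReal.zero_ne_top).comp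
        (ENNReal.tendsto_tsum_compl_atTop_zero h')
      have htail2 := (Real.continuous_sqrt.tendsto _).comp htail
      simp only [ENNReal.toReal_zero, Real.sqrt_zero] at htail2
      refine squeeze_zero (fun _ => norm_nonneg _) (fun F => ?_) htail2
      rw [norm_sub_rev]
      refine ContinuousLinearMap.opNorm_le_bound _ (Real.sqrt_nonneg _) fun x => ?_
      have h3 := norm_sub_sum_inner_smul_sq_le b hR F x
      have hfin : (∑' i : {i // i ∉ F}, ENNReal.ofReal (‖R (b i)‖ ^ 2)) ≠ ∞ :=
        ne_top_of_le_ne_top h' (ENNReal.tsum_comp_le_tsum_of_injective Subtype.val_injective _)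
      rw [ENNReal.ofReal_le_iff_le_toReal (ENNReal.mul_ne_top hfin ENNReal.ofReal_ne_top),
        ENNReal.toReal_mul, ENNReal.toReal_ofReal (sq_nonneg _)] at h3
      refine (sq_le_sq₀ (norm_nonneg _)
        (mul_nonneg (Real.sqrt_nonneg _) (norm_nonneg _))).1 ?_
      simp only [Function.comp_apply]
      rw [mul_pow, Real.sq_sqrt ENNReal.toReal_nonneg, sub_apply, hPx]
      exact h3
    · have hsum : IsCompactOperator
          (∑ i ∈ F, InnerProductSpace.rankOne ℂ (b i) (b i) : H →L[ℂ] H) :=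
        isCompactOperator_sum F fun i =>
          (isCompactOperator_of_locallyCompactSpace_dom (innerSL ℂ (b i))).clm_comp
            (ContinuousLinearMap.toSpanSingleton ℂ (b i))
      exact hsum.comp_clm R
  have : (B : H → H) = R ∘ R := by
    conv_lhs => rw [← CFC.sqrt_mul_sqrt_self B hB]
    rfl
  rw [this]
  exact hRc.clm_comp R

theorem continuousOn_rpow {p : ℝ} (hp : 0 ≤ p) (s : Set ℝ) :
    ContinuousOn (fun x : ℝ => x ^ p) s :=
  (Real.continuous_rpow_const hp).continuousOn

/-- If a power of a positive operator is compact, so is the operator: with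
`g x = x / (max x ε) ^ p` the compact operator `a ^ p * g a` is within `ε` of `a`. -/
theorem isCompactOperator_of_rpow {a : H →L[ℂ] H} (ha : 0 ≤ a) {p : ℝ} (hp : 0 < p)
    (h : IsCompactOperator (a ^ p)) : IsCompactOperator a := by
  have hsa : IsSelfAdjoint a := IsSelfAdjoint.of_nonneg ha
  let g : ℝ → ℝ → ℝ := fun ε x => x / (max x ε) ^ p
  have hg : ∀ ε, 0 < ε → Continuous (g ε) := fun ε hε => by
    refine continuous_id.div ((continuous_id.max continuous_const).rpow_const fun x => Or.inr hp.le)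
      fun x => ?_
    exact (Real.rpow_pos_of_pos (lt_max_of_lt_right hε) p).ne'
  refine isCompactOperator_of_tendsto (F := fun ε : ℝ => a ^ p * cfc (g ε) a) (l := 𝓝[>] 0) ?_
    (Eventually.of_forall fun ε => h.comp_clm _)
  rw [tendsto_iff_norm_sub_tendsto_zero]
  -- By the functional calculus it is enough that `|x - x ^ p * g ε x| ≤ ε` for `x ≥ 0`.
  refine squeeze_zero' (Eventually.of_forall fun _ => norm_nonneg _) ?_
    (tendsto_id.mono_left nhdsWithin_le_nhds)
  filter_upwards [self_mem_nhdsWithin] with ε hε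
  have hε : 0 < ε := hε
  rw [norm_sub_rev, id, CFC.rpow_eq_cfc_real ha,
    ← cfc_mul _ _ a (continuousOn_rpow hp.le _) (hg ε hε).continuousOn]
  conv_lhs => enter [1, 1]; rw [← cfc_id ℝ a]
  rw [← cfc_sub id (fun x => x ^ p * g ε x) a continuousOn_id
    ((continuousOn_rpow hp.le _).mul (hg ε hε).continuousOn)]
  refine norm_cfc_le hε.le fun x hx => ?_
  have hx0 : 0 ≤ x := spectrum_nonneg_of_nonneg ha hx
  simp only [id, g]
  rcases le_total ε x with hle | hle
  · have hxp : x ^ p ≠ 0 := (Real.rpow_pos_of_pos (hε.trans_le hle) p).ne'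
    rw [max_eq_left hle, mul_div_cancel₀ _ hxp]
    simpa using hε.le
  · rw [max_eq_right hle]
    have h1 : x ^ p ≤ ε ^ p := Real.rpow_le_rpow hx0 hle hp.le
    have h2 : 0 < ε ^ p := Real.rpow_pos_of_pos hε p
    have h3 : x ^ p * (x / ε ^ p) ≤ x := by
      rw [mul_div_assoc', div_le_iff₀ h2, mul_comm]
      gcongr
    have h4 : 0 ≤ x ^ p * (x / ε ^ p) := by positivity
    rw [Real.norm_eq_abs, abs_le]
    constructor <;> linarith

/-- Orthonormal bases of mutually orthogonal closed subspaces that span a dense subspace make up an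
orthonormal basis of the whole space. -/
theorem OrthogonalFamily.exists_hilbertBasis_mem.{u, v} {H : Type u}
    [NormedAddCommGroup H] [InnerProductSpace ℂ H] [CompleteSpace H] {κ : Type v}
    {E : κ → Submodule ℂ H}
    (hE : ∀ k, IsClosed (E k : Set H)) (horth : OrthogonalFamily ℂ (fun k => E k)
      fun k => (E k).subtypeₗᵢ) (hbot : (⨆ k, E k)ᗮ = ⊥) :
    ∃ (ι : Type (max v u)) (b : HilbertBasis ι ℂ H) (k : ι → κ), ∀ i, b i ∈ E (k i) := by
  have hcomp : ∀ k, CompleteSpace (E k) := fun k => (hE k).completeSpace_coe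
  choose w e _ using fun k => exists_hilbertBasis ℂ (E k)
  have hon : Orthonormal ℂ fun a : Σ k, w k => ((e a.1 a.2 : E a.1) : H) :=
    horth.orthonormal_sigma_orthonormal (v_family := fun k => e k) fun k => (e k).orthonormal
  have hbot' : (Submodule.span ℂ
      (Set.range fun a : Σ k, w k => ((e a.1 a.2 : E a.1) : H)))ᗮ = ⊥ := by
    rw [eq_bot_iff, ← hbot, ← Submodule.iInf_orthogonal]
    refine fun x hx => Submodule.mem_iInf _ |>.2 fun k => (Submodule.mem_orthogonal' _ _).2
      fun y hy => ?_
    have hsum := (((e k).hasSum_repr ⟨y, hy⟩).mapL (E k).subtypeL).mapL (innerSL ℂ x)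
    refine hsum.unique ?_
    have hzero : ∀ i, innerSL ℂ x ((E k).subtypeL ((e k).repr ⟨y, hy⟩ i • e k i)) = 0 := fun i => by
      have h0 : inner ℂ x ((e k i : E k) : H) = 0 :=
        (Submodule.mem_orthogonal' _ _).1 hx _ (Submodule.subset_span ⟨⟨k, i⟩, rfl⟩)
      rw [map_smul, map_smul, innerSL_apply_apply, Submodule.subtypeL_apply, h0, smul_zero]
    simp only [hzero]
    exact hasSum_zero
  have hb := HilbertBasis.coe_mkOfOrthogonalEqBot hon hbot'
  set b := HilbertBasis.mkOfOrthogonalEqBot hon hbot'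
  clear_value b
  refine ⟨Σ k, w k, b, Sigma.fst, fun a => ?_⟩
  rw [congrFun hb a]
  exact (e a.1 a.2).2

/-- A compact self-adjoint operator has an orthonormal basis of eigenvectors. -/
theorem exists_hilbertBasis_eigenvectors.{u} {H : Type u} [NormedAddCommGroup H]
    [InnerProductSpace ℂ H] [CompleteSpace H] {C : H →L[ℂ] H} (hC : IsSelfAdjoint C)
    (hc : IsCompactOperator C) :
    ∃ (ι : Type u) (b : HilbertBasis ι ℂ H) (μ : ι → ℂ), ∀ i, C (b i) = μ i • b i := by
  have hsym : (C : H →ₗ[ℂ] H).IsSymmetric := hC.isSymmetric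
  have hclosed : ∀ μ, IsClosed (Module.End.eigenspace (C : H →ₗ[ℂ] H) μ : Set H) := fun μ => by
    have : (Module.End.eigenspace (C : H →ₗ[ℂ] H) μ : Set H) = {x | C x = μ • x} := by
      ext x
      exact Module.End.mem_eigenspace_iff
    rw [this]
    exact isClosed_eq C.continuous (continuous_const_smul μ)
  obtain ⟨ι, b, μ, hb⟩ := OrthogonalFamily.exists_hilbertBasis_mem
    (E := fun μ => Module.End.eigenspace (C : H →ₗ[ℂ] H) μ) hclosed
    hsym.orthogonalFamily_eigenspaces
    (ContinuousLinearMap.orthogonalComplement_iSup_eigenspaces_eq_bot hc hsym)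
  exact ⟨ι, b, μ, fun i => Module.End.mem_eigenspace_iff.1 (hb i)⟩

end Compact

/-! ### Scalar inequalities -/

section Scalar

theorem rpow_sub_one_mul_self {p : ℝ} (hp : 1 < p) {t : ℝ} (ht : 0 ≤ t) :
    t ^ (p - 1) * t = t ^ p := by
  nth_rw 2 [← Real.rpow_one t]
  rw [← Real.rpow_add_of_nonneg ht (by linarith) zero_le_one, sub_add_cancel]

/-- Young's inequality, in the form of the tangent line inequality for `x ↦ x ^ p` at `t`. -/
theorem mul_rpow_sub_one_mul_le {p : ℝ} (hp : 1 < p) {t x : ℝ} (ht : 0 ≤ t) (hx : 0 ≤ x) :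
    p * t ^ (p - 1) * x ≤ (p - 1) * t ^ p + x ^ p := by
  have h := Real.young_inequality_of_nonneg hx (Real.rpow_nonneg ht (p - 1))
    (Real.HolderConjugate.conjExponent hp)
  have hp1 : p - 1 ≠ 0 := by linarith
  have hpow : (t ^ (p - 1)) ^ p.conjExponent = t ^ p := by
    rw [← Real.rpow_mul ht, Real.conjExponent]
    congr 1
    field_simp
  rw [hpow, Real.conjExponent] at h
  have h2 := mul_le_mul_of_nonneg_left h (by linarith : (0 : ℝ) ≤ p)
  have h3 : p * (x ^ p / p + t ^ p / (p / (p - 1))) = (p - 1) * t ^ p + x ^ p := by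
    field_simp
    ring
  linarith

/-- The step of Elliott's proof of Hardy's inequality for real sequences: if `c` is the mean of `n`
terms with mean `z` and of one further term `y`, then `c ^ p` is bounded by `y ^ p` up to terms that
telescope. -/
theorem hardy_step {p : ℝ} (hp : 1 < p) {n : ℝ} (hn : 0 ≤ n) {y z c : ℝ} (hy : 0 ≤ y)
    (hz : 0 ≤ z) (hc : 0 ≤ c) (h : (n + 1) * c = n * z + y) :
    (1 + p / (p - 1) * (n + 1)) * c ^ p ≤
      (p / (p - 1)) ^ p * y ^ p + p / (p - 1) * n * z ^ p := by
  have hp1 : 0 < p - 1 := by linarith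
  set q := p / (p - 1) with hq
  have hq0 : 0 < q := by positivity
  have hqp : q * (p - 1) = p := by rw [hq]; field_simp
  have h1 := mul_rpow_sub_one_mul_le hp hc (mul_nonneg hq0.le hy)
  have h2 := mul_rpow_sub_one_mul_le hp hc hz
  rw [Real.mul_rpow hq0.le hy] at h1
  have hcp := rpow_sub_one_mul_self hp hc
  -- `h1` is the tangent line inequality for `q * y`, `h2` that for `z`; substituting
  -- `y = (n + 1) * c - n * z` in `h1` produces the cross term that `h2` bounds.
  have h3 : p * c ^ (p - 1) * (q * y) =
      p * q * (n + 1) * c ^ p - q * n * (p * c ^ (p - 1) * z) := by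
    have : y = (n + 1) * c - n * z := by linarith
    rw [this, ← hcp]
    ring
  have h4 := mul_le_mul_of_nonneg_left h2 (mul_nonneg hq0.le hn)
  have h5 : q * n * ((p - 1) * c ^ p + z ^ p) = p * n * c ^ p + q * n * z ^ p := by
    linear_combination n * c ^ p * hqp
  have h6 : p * q = q + p := by linear_combination hqp
  rw [h6] at h3
  linarith

end Scalar

/-! ### Powers of positive operators at a unit vector -/

section Power

variable {H : Type*} [NormedAddCommGroup H] [InnerProductSpace ℂ H] [CompleteSpace H]

/-- Jensen's inequality for the spectral measure of `a` at the unit vector `e`. -/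
theorem re_inner_rpow_le {p : ℝ} (hp : 1 < p) {a : H →L[ℂ] H} (ha : 0 ≤ a) {e : H}
    (he : ‖e‖ = 1) : (inner ℂ e (a e)).re ^ p ≤ (inner ℂ e ((a ^ p) e)).re := by
  have hsa : IsSelfAdjoint a := IsSelfAdjoint.of_nonneg ha
  set t := (inner ℂ e (a e)).re with htdef
  have ht : 0 ≤ t := re_inner_apply_nonneg ha e
  have h1 : cfc (fun x : ℝ => p * t ^ (p - 1) * x) a ≤
      cfc (fun x : ℝ => (p - 1) * t ^ p + x ^ p) a := by
    refine cfc_mono (fun x hx => ?_) (by fun_prop)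
      (continuousOn_const.add (continuousOn_rpow (by linarith) _))
    exact mul_rpow_sub_one_mul_le hp ht (spectrum_nonneg_of_nonneg ha hx)
  rw [cfc_const_mul _ _ a, cfc_id' ℝ a,
    cfc_const_add _ _ a (continuousOn_rpow (by linarith) _), ← CFC.rpow_eq_cfc_real ha,
    ← sub_nonneg] at h1
  have h2 := re_inner_apply_nonneg h1 e
  have h3 : (inner ℂ e (((algebraMap ℝ (H →L[ℂ] H)) ((p - 1) * t ^ p) + a ^ p -
      (p * t ^ (p - 1)) • a) e)).re =
      (p - 1) * t ^ p + (inner ℂ e ((a ^ p) e)).re - p * t ^ (p - 1) * t := by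
    rw [Algebra.algebraMap_eq_smul_one]
    simp only [sub_apply, add_apply, smul_apply, inner_sub_right, inner_add_right,
      one_apply_eq_self, inner_smul_right_eq_smul, Complex.sub_re, Complex.add_re,
      Complex.real_smul, Complex.re_ofReal_mul, inner_self_eq_norm_sq_to_K, he]
    simp [htdef]
  rw [h3, mul_assoc, rpow_sub_one_mul_self hp ht] at h2
  linarith

/-- Powers act on eigenvectors through the eigenvalue. The difference quotient of `x ↦ x ^ p` at
`c` is continuous because `p > 1`, so `C ^ p - c ^ p` is a multiple of `C - c`. -/
theorem rpow_apply_eigenvector {p : ℝ} (hp : 1 < p) {C : H →L[ℂ] H} (hC : 0 ≤ C) {e : H} {c : ℝ}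
    (he : C e = c • e) : (C ^ p) e = (c ^ p) • e := by
  have hsa : IsSelfAdjoint C := IsSelfAdjoint.of_nonneg hC
  have hg : Continuous (dslope (fun x : ℝ => x ^ p) c) := by
    rw [← continuousOn_univ, continuousOn_dslope Filter.univ_mem]
    exact ⟨continuousOn_rpow (by linarith) _,
      (Real.hasDerivAt_rpow_const (Or.inr hp.le)).differentiableAt⟩
  have h1 : (fun x : ℝ => x ^ p) =
      fun x => c ^ p + dslope (fun x : ℝ => x ^ p) c x * (x - c) := by
    funext x
    have := sub_smul_dslope (fun x : ℝ => x ^ p) c x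
    simp only [smul_eq_mul] at this
    linarith
  rw [CFC.rpow_eq_cfc_real hC, h1, cfc_const_add _ _ C (by fun_prop),
    cfc_mul _ _ C hg.continuousOn (by fun_prop), cfc_sub _ _ C (by fun_prop) (by fun_prop),
    cfc_id' ℝ C, cfc_const c C]
  simp [Algebra.algebraMap_eq_smul_one, he]

end Power

/-! ### Hardy's inequality for the trace -/

section Hardy

variable {H : Type*} [NormedAddCommGroup H] [InnerProductSpace ℂ H] [CompleteSpace H]

/-- Elliott's step for the trace: `hardy_step` summed over an eigenbasis of `C`, in which the diagonal entries
of `A` and `B` to the power `p` are bounded by those of `A ^ p` and `B ^ p`. -/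
theorem traceENN_hardy_step {p : ℝ} (hp : 1 < p) {n : ℝ} (hn : 0 ≤ n) {A B C : H →L[ℂ] H}
    (hA : 0 ≤ A) (hB : 0 ≤ B) (hC : 0 ≤ C) (hc : IsCompactOperator C)
    (h : (n + 1) • C = n • B + A) :
    ENNReal.ofReal (1 + p / (p - 1) * (n + 1)) * traceENN (C ^ p) ≤
      ENNReal.ofReal ((p / (p - 1)) ^ p) * traceENN (A ^ p) +
        ENNReal.ofReal (p / (p - 1) * n) * traceENN (B ^ p) := by
  have hq : 0 ≤ p / (p - 1) := div_nonneg (by linarith) (by linarith)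
  obtain ⟨ι, b, μ, hb⟩ := exists_hilbertBasis_eigenvectors (IsSelfAdjoint.of_nonneg hC) hc
  have hnorm : ∀ i, ‖b i‖ = 1 := b.orthonormal.1
  rw [traceENN_eq_of_basis b CFC.rpow_nonneg, traceENN_eq_of_basis b CFC.rpow_nonneg,
    traceENN_eq_of_basis b CFC.rpow_nonneg, ← ENNReal.tsum_mul_left, ← ENNReal.tsum_mul_left,
    ← ENNReal.tsum_mul_left, ← ENNReal.tsum_add]
  refine ENNReal.tsum_le_tsum fun i => ?_
  have hqp : 0 ≤ (p / (p - 1)) ^ p := Real.rpow_nonneg hq p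
  have hqn : 0 ≤ p / (p - 1) * n := mul_nonneg hq hn
  have hqn1 : 0 ≤ 1 + p / (p - 1) * (n + 1) := by nlinarith
  have hAp := re_inner_apply_nonneg (CFC.rpow_nonneg (a := A) (y := p)) (b i)
  have hBp := re_inner_apply_nonneg (CFC.rpow_nonneg (a := B) (y := p)) (b i)
  rw [← ENNReal.ofReal_mul hqn1, ← ENNReal.ofReal_mul hqp, ← ENNReal.ofReal_mul hqn,
    ← ENNReal.ofReal_add (mul_nonneg hqp hAp) (mul_nonneg hqn hBp)]
  refine ENNReal.ofReal_le_ofReal ?_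
  have hinner : inner ℂ (b i) (C (b i)) = μ i := by
    rw [hb, inner_smul_right, inner_self_eq_norm_sq_to_K, hnorm]
    simp
  set c : ℝ := (inner ℂ (b i) (C (b i))).re with hcdef
  have hc0 : 0 ≤ c := re_inner_apply_nonneg hC (b i)
  have hCi : C (b i) = c • b i := by
    have hreal : inner ℂ (b i) (C (b i)) = (c : ℂ) := by
      rw [hcdef, inner_eq_norm_sqrt_sq C hC, Complex.ofReal_re]
    rw [hb, ← hinner, hreal, Complex.coe_smul]
  have hcp : (inner ℂ (b i) ((C ^ p) (b i))).re = c ^ p := by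
    rw [rpow_apply_eigenvector hp hC hCi, inner_smul_right_eq_smul,
      inner_self_eq_norm_sq_to_K, hnorm]
    simp
  have hmean : (n + 1) * c = n * (inner ℂ (b i) (B (b i))).re + (inner ℂ (b i) (A (b i))).re := by
    have := congrArg (fun T : H →L[ℂ] H => (inner ℂ (b i) (T (b i))).re) h
    simpa [inner_add_right, inner_smul_right_eq_smul, ← hcdef] using this
  rw [hcp]
  refine (hardy_step hp hn (re_inner_apply_nonneg hA (b i)) (re_inner_apply_nonneg hB (b i)) hc0
    hmean).trans ?_
  gcongr
  · exact re_inner_rpow_le hp hA (hnorm i)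
  · exact re_inner_rpow_le hp hB (hnorm i)

theorem hardyMean_nonneg {a : ℕ → H →L[ℂ] H} (ha : ∀ n, 0 ≤ a n) (n : ℕ) : 0 ≤ hardyMean a n :=
  smul_nonneg (by positivity) (Finset.sum_nonneg fun k _ => ha k)

/-- Hardy's inequality for the traces of finitely many terms. The last summand on the left is what
makes the telescoping induction go through. -/
theorem sum_traceENN_hardyMean_le {p : ℝ} (hp : 1 < p) {a : ℕ → H →L[ℂ] H} (ha : ∀ n, 0 ≤ a n)
    (hc : ∀ n, IsCompactOperator (a n)) (N : ℕ) :
    ∑ n ∈ Finset.range (N + 1), traceENN (hardyMean a n ^ p) +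
        ENNReal.ofReal (p / (p - 1) * (N + 1)) * traceENN (hardyMean a N ^ p) ≤
      ENNReal.ofReal ((p / (p - 1)) ^ p) * ∑ n ∈ Finset.range (N + 1), traceENN (a n ^ p) := by
  have hq : 0 ≤ p / (p - 1) := div_nonneg (by linarith) (by linarith)
  have hcm : ∀ n, IsCompactOperator (hardyMean a n) := fun n =>
    (isCompactOperator_sum (Finset.range (n + 1)) hc).smul (((n : ℝ) + 1)⁻¹)
  have hsplit : ∀ n : ℝ, 0 ≤ n → ENNReal.ofReal (1 + p / (p - 1) * (n + 1)) =
      1 + ENNReal.ofReal (p / (p - 1) * (n + 1)) := fun n hn => by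
    rw [ENNReal.ofReal_add zero_le_one (by positivity), ENNReal.ofReal_one]
  induction N with
  | zero =>
    have h := traceENN_hardy_step hp le_rfl (ha 0) le_rfl (hardyMean_nonneg ha 0) (hcm 0)
      (by simp [hardyMean])
    rw [hsplit 0 le_rfl, add_mul, one_mul, mul_zero, ENNReal.ofReal_zero, zero_mul, add_zero] at h
    simpa using h
  | succ N ih =>
    have h := traceENN_hardy_step hp (n := (N : ℝ) + 1) (by positivity) (ha (N + 1))
      (hardyMean_nonneg ha N) (hardyMean_nonneg ha (N + 1)) (hcm (N + 1)) (by
        have h1 : (N : ℝ) + 1 ≠ 0 := by positivity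
        have h2 : (N : ℝ) + 1 + 1 ≠ 0 := by positivity
        rw [hardyMean, hardyMean, Nat.cast_add, Nat.cast_one, smul_inv_smul₀ h2,
          smul_inv_smul₀ h1, ← Finset.sum_range_succ])
    rw [hsplit _ (by positivity), add_mul, one_mul] at h
    rw [Finset.sum_range_succ, Finset.sum_range_succ _ (N + 1), mul_add (ENNReal.ofReal _) (∑ n ∈ _, _),
      Nat.cast_add, Nat.cast_one,
      add_assoc]
    calc _ ≤ ∑ n ∈ Finset.range (N + 1), traceENN (hardyMean a n ^ p) +
          (ENNReal.ofReal ((p / (p - 1)) ^ p) * traceENN (a (N + 1) ^ p) +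
          ENNReal.ofReal (p / (p - 1) * (N + 1)) * traceENN (hardyMean a N ^ p)) :=
          add_le_add le_rfl h
      _ = (∑ n ∈ Finset.range (N + 1), traceENN (hardyMean a n ^ p) +
          ENNReal.ofReal (p / (p - 1) * (N + 1)) * traceENN (hardyMean a N ^ p)) +
          ENNReal.ofReal ((p / (p - 1)) ^ p) * traceENN (a (N + 1) ^ p) := by ring
      _ ≤ _ := add_le_add ih le_rfl

/-- Hardy's inequality for the traces of positive operators. -/
theorem tsum_traceENN_hardyMean_le {p : ℝ} (hp : 1 < p) {a : ℕ → H →L[ℂ] H} (ha : ∀ n, 0 ≤ a n)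
    (h : ∑' n, traceENN (a n ^ p) ≠ ∞) :
    ∑' n, traceENN (hardyMean a n ^ p) ≤
      ENNReal.ofReal ((p / (p - 1)) ^ p) * ∑' n, traceENN (a n ^ p) := by
  have hc : ∀ n, IsCompactOperator (a n) := fun n =>
    isCompactOperator_of_rpow (ha n) (by linarith : 0 < p)
      (isCompactOperator_of_traceENN_ne_top CFC.rpow_nonneg (ENNReal.ne_top_of_tsum_ne_top h n))
  rw [ENNReal.tsum_eq_iSup_nat]
  refine iSup_le fun N => ?_
  calc _ ≤ ∑ n ∈ Finset.range (N + 1), traceENN (hardyMean a n ^ p) :=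
        Finset.sum_le_sum_of_subset (Finset.range_mono N.le_succ)
    _ ≤ _ := le_self_add.trans (sum_traceENN_hardyMean_le hp ha hc N)
    _ ≤ _ := by gcongr; exact ENNReal.sum_le_tsum _

/-- Hardy's inequality for trace class sums, together with the existence of the sum of the powers of
the means. -/
theorem exists_hardy_sum {p : ℝ} (hp : 1 < p) {a : ℕ → H →L[ℂ] H} (ha : ∀ n, 0 ≤ a n)
    {S : H →L[ℂ] H} (hS : HasOperatorSum (fun n => a n ^ p) S) (hSt : IsTraceClass S) :
    ∃ T : H →L[ℂ] H, HasOperatorSum (fun n => hardyMean a n ^ p) T ∧ IsTraceClass T ∧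
      (operatorTrace T).re ≤ (p / (p - 1)) ^ p * (operatorTrace S).re := by
  have hq : 0 ≤ p / (p - 1) := div_nonneg (by linarith) (by linarith)
  have hS0 : 0 ≤ S := hS.nonneg fun n => CFC.rpow_nonneg
  have hSfin := (isTraceClass_iff_traceENN_ne_top hS0).1 hSt
  have hSeq := hS.traceENN_eq fun n => CFC.rpow_nonneg
  have hle := tsum_traceENN_hardyMean_le hp ha (hSeq ▸ hSfin)
  rw [← hSeq] at hle
  have hfin : ENNReal.ofReal ((p / (p - 1)) ^ p) * traceENN S ≠ ∞ :=
    ENNReal.mul_ne_top ENNReal.ofReal_ne_top hSfin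
  obtain ⟨T, hT⟩ := exists_hasOperatorSum_of_tsum_traceENN_ne_top
    (A := fun n => hardyMean a n ^ p) (fun n => CFC.rpow_nonneg) (ne_top_of_le_ne_top hfin hle)
  have hT0 : 0 ≤ T := hT.nonneg fun n => CFC.rpow_nonneg
  have hTeq := hT.traceENN_eq fun n => CFC.rpow_nonneg
  rw [← hTeq] at hle
  refine ⟨T, hT, (isTraceClass_iff_traceENN_ne_top hT0).2 (ne_top_of_le_ne_top hfin hle), ?_⟩
  rw [operatorTrace_re_eq_toReal hT0, operatorTrace_re_eq_toReal hS0]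
  have := ENNReal.toReal_mono hfin hle
  rwa [ENNReal.toReal_mul, ENNReal.toReal_ofReal (Real.rpow_nonneg hq p)] at this

end Hardy

/-! ### The critical real sequence -/

section Sharp

open Filter Topology

/-- Lower bound for the partial sums of the critical sequence `k ^ (-1 / p)`, by comparison with the
concave function `p / (p - 1) * x ^ (1 - 1 / p)`. -/
theorem le_sum_rpow_neg_inv {p : ℝ} (hp : 1 < p) (n : ℕ) :
    p / (p - 1) * ((n + 1 : ℝ) ^ (1 - p⁻¹) - 1) ≤
      ∑ k ∈ Finset.range n, ((k : ℝ) + 1) ^ (-p⁻¹) := by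
  have hp0 : 0 < p := by linarith
  have hp1 : 0 < p - 1 := by linarith
  have hinv : p⁻¹ ≤ 1 := inv_le_one_of_one_le₀ hp.le
  have hqr : p / (p - 1) * (1 - p⁻¹) = 1 := by field_simp
  induction n with
  | zero => simp
  | succ n ih =>
    rw [Finset.sum_range_succ]
    have hx : (0 : ℝ) < n + 1 := by positivity
    have hstep : ((n + 1 : ℕ) + 1 : ℝ) ^ (1 - p⁻¹) ≤
        (n + 1 : ℝ) ^ (1 - p⁻¹) + (1 - p⁻¹) * (n + 1 : ℝ) ^ (-p⁻¹) := by
      have hb := rpow_one_add_le_one_add_mul_self (s := ((n : ℝ) + 1)⁻¹)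
        (by have : 0 < ((n : ℝ) + 1)⁻¹ := by positivity
            linarith) (p := 1 - p⁻¹) (by linarith) (by simp [hp0.le])
      have hfac : ((n + 1 : ℕ) + 1 : ℝ) = (n + 1 : ℝ) * (1 + ((n : ℝ) + 1)⁻¹) := by
        push_cast
        field_simp
      have hpow : (n + 1 : ℝ) ^ (-p⁻¹) = (n + 1 : ℝ) ^ (1 - p⁻¹) * ((n : ℝ) + 1)⁻¹ := by
        rw [← Real.rpow_neg_one ((n : ℝ) + 1), ← Real.rpow_add hx]
        congr 1
        ring
      rw [hfac, Real.mul_rpow hx.le (by positivity), hpow]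
      have := mul_le_mul_of_nonneg_left hb (Real.rpow_nonneg hx.le (1 - p⁻¹))
      linarith
    have hmul := mul_le_mul_of_nonneg_left hstep (by positivity : 0 ≤ p / (p - 1))
    have : p / (p - 1) * ((1 - p⁻¹) * (n + 1 : ℝ) ^ (-p⁻¹)) = (n + 1 : ℝ) ^ (-p⁻¹) := by
      rw [← mul_assoc, hqr, one_mul]
    linarith

/-- The `p`-th powers of the means of the critical sequence exceed `D / (n + 1)` from some point
on, for every `D` below Hardy's constant. -/
theorem eventually_le_mean_rpow {p : ℝ} (hp : 1 < p) {D : ℝ} (hD : D < (p / (p - 1)) ^ p) :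
    ∀ᶠ n : ℕ in atTop, D * (1 / ((n : ℝ) + 1)) ≤
      (((n : ℝ) + 1)⁻¹ * ∑ k ∈ Finset.range (n + 1), ((k : ℝ) + 1) ^ (-p⁻¹)) ^ p := by
  have hp0 : 0 < p := by linarith
  have hp1 : 0 < p - 1 := by linarith
  have hinv : p⁻¹ < 1 := inv_lt_one_of_one_lt₀ hp
  have hlim : Tendsto (fun n : ℕ => (p / (p - 1) * (1 - ((n : ℝ) + 1) ^ (-(1 - p⁻¹)))) ^ p) atTop
      (𝓝 ((p / (p - 1)) ^ p)) := by
    have h0 : Tendsto (fun n : ℕ => ((n : ℝ) + 1) ^ (-(1 - p⁻¹))) atTop (𝓝 0) :=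
      (tendsto_rpow_neg_atTop (by linarith : 0 < 1 - p⁻¹)).comp
        (tendsto_atTop_add_const_right _ _ tendsto_natCast_atTop_atTop)
    have h1 := ((h0.const_sub 1).const_mul (p / (p - 1))).rpow_const (p := p) (Or.inr hp0.le)
    simpa using h1
  filter_upwards [hlim.eventually_const_lt hD] with n hn
  have hx : (0 : ℝ) < n + 1 := by positivity
  have hx1 : (1 : ℝ) ≤ n + 1 := by simp
  have hsmall : ((n : ℝ) + 1) ^ (-(1 - p⁻¹)) ≤ 1 :=
    Real.rpow_le_one_of_one_le_of_nonpos hx1 (by linarith)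
  set u := p / (p - 1) * (1 - ((n : ℝ) + 1) ^ (-(1 - p⁻¹))) with hu
  have hu0 : 0 ≤ u := mul_nonneg (by positivity) (by linarith)
  have hroot : (1 / ((n : ℝ) + 1)) = (((n : ℝ) + 1) ^ (-p⁻¹)) ^ p := by
    rw [← Real.rpow_mul hx.le, neg_mul, inv_mul_cancel₀ hp0.ne', Real.rpow_neg_one, one_div]
  calc D * (1 / ((n : ℝ) + 1)) ≤ u ^ p * (1 / ((n : ℝ) + 1)) := by gcongr
    _ = (u * ((n : ℝ) + 1) ^ (-p⁻¹)) ^ p := by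
        rw [hroot, ← Real.mul_rpow hu0 (by positivity)]
    _ ≤ _ := by
      refine Real.rpow_le_rpow (by positivity) ?_ hp0.le
      have hsum : p / (p - 1) * ((n + 1 : ℝ) ^ (1 - p⁻¹) - 1) ≤
          ∑ k ∈ Finset.range (n + 1), ((k : ℝ) + 1) ^ (-p⁻¹) := by
        refine le_trans ?_ (le_sum_rpow_neg_inv hp (n + 1))
        push_cast
        gcongr
        linarith
      have h1 : u * ((n : ℝ) + 1) ^ (-p⁻¹) =
          ((n : ℝ) + 1)⁻¹ * (p / (p - 1) * ((n + 1 : ℝ) ^ (1 - p⁻¹) - 1)) := by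
        have e1 : ((n : ℝ) + 1) ^ (-p⁻¹) = ((n : ℝ) + 1)⁻¹ * ((n : ℝ) + 1) ^ (1 - p⁻¹) := by
          rw [← Real.rpow_neg_one ((n : ℝ) + 1), ← Real.rpow_add hx]
          congr 1
          ring
        have e2 : ((n : ℝ) + 1) ^ (-(1 - p⁻¹)) * ((n : ℝ) + 1) ^ (1 - p⁻¹) = 1 := by
          rw [← Real.rpow_add hx, neg_add_cancel, Real.rpow_zero]
        rw [hu, e1]
        linear_combination (-(p / (p - 1) * ((n : ℝ) + 1)⁻¹)) * e2
      rw [h1]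
      gcongr

/-- Hardy's constant cannot be lowered for real sequences: both sums below are comparable with the
harmonic series, with ratio tending to the constant. -/
theorem exists_lt_sum_mean_rpow {p : ℝ} (hp : 1 < p) {C : ℝ} (hC : C < (p / (p - 1)) ^ p) :
    ∃ N : ℕ, C * ∑ n ∈ Finset.range N, 1 / ((n : ℝ) + 1) <
      ∑ n ∈ Finset.range N,
        (((n : ℝ) + 1)⁻¹ * ∑ k ∈ Finset.range (n + 1), ((k : ℝ) + 1) ^ (-p⁻¹)) ^ p := by
  obtain ⟨D, hCD, hD⟩ := exists_between hC
  obtain ⟨m, hm⟩ := eventually_atTop.1 (eventually_le_mean_rpow hp hD)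
  set f : ℕ → ℝ := fun n =>
    (((n : ℝ) + 1)⁻¹ * ∑ k ∈ Finset.range (n + 1), ((k : ℝ) + 1) ^ (-p⁻¹)) ^ p
  set h : ℕ → ℝ := fun n => 1 / ((n : ℝ) + 1)
  have hf0 : ∀ n, 0 ≤ f n := fun n => by positivity
  have hdiv : Tendsto (fun N => ∑ n ∈ Finset.range N, h n) atTop atTop :=
    Real.tendsto_sum_range_one_div_nat_succ_atTop
  obtain ⟨N, hmN, hN⟩ := ((eventually_ge_atTop m).and (hdiv.eventually_gt_atTop
    (D * (∑ n ∈ Finset.range m, h n) / (D - C)))).exists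
  refine ⟨N, ?_⟩
  rw [div_lt_iff₀ (by linarith)] at hN
  have h1 := Finset.sum_range_add_sum_Ico h hmN
  have h2 := Finset.sum_range_add_sum_Ico f hmN
  have h3 : D * ∑ n ∈ Finset.Ico m N, h n ≤ ∑ n ∈ Finset.Ico m N, f n := by
    rw [Finset.mul_sum]
    exact Finset.sum_le_sum fun n hn => hm n (Finset.mem_Ico.1 hn).1
  have h4 : 0 ≤ ∑ n ∈ Finset.range m, f n := Finset.sum_nonneg fun n _ => hf0 n
  rw [← h2]
  have h5 : D * ∑ n ∈ Finset.range N, h n =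
      D * (∑ n ∈ Finset.range m, h n) + D * ∑ n ∈ Finset.Ico m N, h n := by
    rw [← h1, mul_add]
  linarith

end Sharp

/-! ### Sequences of multiples of a rank one projection -/

section RankOne

variable {H : Type*} [NormedAddCommGroup H] [InnerProductSpace ℂ H]

theorem isIdempotentElem_rankOne {e : H} (he : ‖e‖ = 1) :
    IsIdempotentElem (InnerProductSpace.rankOne ℂ e e : H →L[ℂ] H) := by
  ext x
  simp [inner_self_eq_norm_sq_to_K, he]

variable [CompleteSpace H]

theorem smul_projection_rpow {p : ℝ} (hp : 0 < p) {P : H →L[ℂ] H} (hP0 : 0 ≤ P)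
    (hP : IsIdempotentElem P) {c : ℝ} (hc : 0 ≤ c) : (c • P) ^ p = c ^ p • P := by
  have hsa : IsSelfAdjoint P := IsSelfAdjoint.of_nonneg hP0
  have hspec := (isIdempotentElem_iff_spectrum_subset ℝ P hsa).1 hP
  rw [CFC.rpow_eq_cfc_real (smul_nonneg hc hP0),
    ← cfc_comp_smul c _ P (continuousOn_rpow hp.le _)]
  have : (spectrum ℝ P).EqOn (fun x => (c • x) ^ p) (fun x => c ^ p * x) := by
    intro x hx
    rcases hspec hx with rfl | rfl
    · simp [hp.ne']
    · simp
  rw [cfc_congr this, cfc_const_mul _ _ P, cfc_id' ℝ P]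

theorem traceENN_smul_rankOne {e : H} (he : ‖e‖ = 1) {c : ℝ} (hc : 0 ≤ c) :
    traceENN (c • InnerProductSpace.rankOne ℂ e e) = ENNReal.ofReal c := by
  have h : ∀ i, ENNReal.ofReal (inner ℂ (refBasis H i)
      ((c • InnerProductSpace.rankOne ℂ e e : H →L[ℂ] H) (refBasis H i))).re =
      ENNReal.ofReal c * ENNReal.ofReal (‖inner ℂ (refBasis H i) e‖ ^ 2) := fun i => by
    rw [← ENNReal.ofReal_mul hc]
    congr 1
    rw [smul_apply, InnerProductSpace.rankOne_apply, inner_smul_right_eq_smul, inner_smul_right,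
      ← inner_conj_symm e, ← Complex.normSq_eq_conj_mul_self, Complex.real_smul,
      Complex.re_ofReal_mul, Complex.ofReal_re, Complex.normSq_eq_norm_sq]
  rw [traceENN, tsum_congr h, ENNReal.tsum_mul_left, ← ennreal_parseval, he]
  simp

end RankOne

theorem mainTheorem4 {H : Type*} [NormedAddCommGroup H] [InnerProductSpace ℂ H] [CompleteSpace H]
    (p : ℝ) (hp : 1 < p) :
    -- the inequality, with the existence of the operator on its left-hand side
    (∀ a : ℕ → H →L[ℂ] H, (∀ n, 0 ≤ a n) →
      ∀ S : H →L[ℂ] H, HasOperatorSum (fun n => a n ^ p) S → IsTraceClass S →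
        ∃ T : H →L[ℂ] H, HasOperatorSum (fun n => hardyMean a n ^ p) T ∧ IsTraceClass T ∧
          (operatorTrace T).re ≤ (p / (p - 1)) ^ p * (operatorTrace S).re) ∧
    -- the constant is best possible, even for sequences with finitely many non-zero terms
    (Nontrivial H → ∀ C : ℝ, C < (p / (p - 1)) ^ p →
      ∃ a : ℕ → H →L[ℂ] H, (∀ n, 0 ≤ a n) ∧ {n | a n ≠ 0}.Finite ∧
        ∃ S T : H →L[ℂ] H, HasOperatorSum (fun n => a n ^ p) S ∧ IsTraceClass S ∧
          HasOperatorSum (fun n => hardyMean a n ^ p) T ∧ IsTraceClass T ∧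
          C * (operatorTrace S).re < (operatorTrace T).re) := by
  refine ⟨fun a ha S hS hSt => exists_hardy_sum hp ha hS hSt, fun hH C hC => ?_⟩
  have hp0 : 0 < p := by linarith
  obtain ⟨e, he⟩ := exists_norm_eq H zero_le_one
  obtain ⟨N, hN⟩ := exists_lt_sum_mean_rpow hp hC
  set P : H →L[ℂ] H := InnerProductSpace.rankOne ℂ e e
  have hP0 : 0 ≤ P := (ContinuousLinearMap.nonneg_iff_isPositive _).2
    (InnerProductSpace.isPositive_rankOne_self e)
  have hPi : IsIdempotentElem P := isIdempotentElem_rankOne he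
  -- The critical sequence, cut off at `N`; the means of index below `N` do not see the cut.
  let c : ℕ → ℝ := fun k => if k < N then ((k : ℝ) + 1) ^ (-p⁻¹) else 0
  have hc0 : ∀ k, 0 ≤ c k := fun k => by
    simp only [c]
    split_ifs
    · positivity
    · exact le_rfl
  have hcp : ∀ k, c k ^ p = if k < N then 1 / ((k : ℝ) + 1) else 0 := fun k => by
    have hx : (0 : ℝ) < k + 1 := by positivity
    simp only [c]
    split_ifs
    · rw [← Real.rpow_mul hx.le, neg_mul, inv_mul_cancel₀ hp0.ne', Real.rpow_neg_one, one_div]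
    · exact Real.zero_rpow hp0.ne'
  let a : ℕ → H →L[ℂ] H := fun k => c k • P
  have ha : ∀ k, 0 ≤ a k := fun k => smul_nonneg (hc0 k) hP0
  have hap : ∀ k, a k ^ p = c k ^ p • P := fun k => smul_projection_rpow hp0 hP0 hPi (hc0 k)
  let m : ℕ → ℝ := fun n => ((n : ℝ) + 1)⁻¹ * ∑ k ∈ Finset.range (n + 1), c k
  have hm0 : ∀ n, 0 ≤ m n := fun n =>
    mul_nonneg (by positivity) (Finset.sum_nonneg fun k _ => hc0 k)
  have hmean : ∀ n, hardyMean a n = m n • P := fun n => by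
    simp only [hardyMean, a, m, ← Finset.sum_smul, smul_smul]
  have hmp : ∀ n, hardyMean a n ^ p = m n ^ p • P := fun n => by
    rw [hmean, smul_projection_rpow hp0 hP0 hPi (hm0 n)]
  set s := ∑ n ∈ Finset.range N, 1 / ((n : ℝ) + 1)
  have hs0 : 0 ≤ s := Finset.sum_nonneg fun n _ => by positivity
  have hS : HasOperatorSum (fun n => a n ^ p) (s • P) := fun x => by
    have hsum : HasSum (fun n => c n ^ p) s := by
      have : s = ∑ n ∈ Finset.range N, c n ^ p :=
        Finset.sum_congr rfl fun n hn => by rw [hcp, if_pos (Finset.mem_range.1 hn)]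
      rw [this]
      exact hasSum_sum_of_ne_finset_zero fun n hn => by
        rw [hcp, if_neg (by simpa using hn)]
    simp only [hap]
    exact hsum.smul_const (P x)
  have hSP : 0 ≤ s • P := smul_nonneg hs0 hP0
  have hStr : traceENN (s • P) = ENNReal.ofReal s := traceENN_smul_rankOne he hs0
  have hSt : IsTraceClass (s • P) := (isTraceClass_iff_traceENN_ne_top hSP).2 (by simp [hStr])
  -- All means from `N` on are non-zero as well; that their powers have a sum is the first part.
  obtain ⟨T, hT, hTt, -⟩ := exists_hardy_sum hp ha hS hSt
  refine ⟨a, ha, (Finset.range N).finite_toSet.subset fun n hn => ?_, s • P, T, hS, hSt, hT, hTt,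
    ?_⟩
  · by_contra hnN
    refine hn ?_
    have : ¬ n < N := by simpa using hnN
    simp [a, c, this]
  have hT0 : 0 ≤ T := hT.nonneg fun n => CFC.rpow_nonneg
  have hTfin := (isTraceClass_iff_traceENN_ne_top hT0).1 hTt
  rw [operatorTrace_re_eq_toReal hSP, operatorTrace_re_eq_toReal hT0, hStr,
    ENNReal.toReal_ofReal hs0]
  refine hN.trans_le ?_
  rw [← ENNReal.ofReal_le_iff_le_toReal hTfin, hT.traceENN_eq fun n => CFC.rpow_nonneg,
    ENNReal.ofReal_sum_of_nonneg fun n _ => by positivity]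
  refine le_trans (Finset.sum_le_sum fun n hn => ?_) (ENNReal.sum_le_tsum (Finset.range N))
  rw [hmp, traceENN_smul_rankOne he (Real.rpow_nonneg (hm0 n) p)]
  refine (congrArg (fun t => ENNReal.ofReal ((((n : ℝ) + 1)⁻¹ * t) ^ p))
    (Finset.sum_congr rfl fun k hk => ?_)).le
  have : k < N := by
    rw [Finset.mem_range] at hn hk
    omega
  simp [c, this]
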